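/- Let $R$ be an integer with $|R|\ge 2$, let $B\subset\mathbb{Z}$ be finite with $0\in B$, $N:=|B|$, and put $\tau_b(x)=(x+b)/R$ for $b\in B$. Let $\mu=\mu(R,B)$ be the unique Borel probability measure on $\mathbb{R}$ with $\mu(E)=\frac1N\sum_{b\in B}\mu(\tau_b^{-1}(E))$ for all Borel sets $E$, let $X_B=\{\sum_{k\ge1}R^{-k}b_k: b_k\in B\}$, and assume that $\mu$ has no overlap: $\mu(\tau_b(X_B)\cap\tau_{b'}(X_B))=0$ for all $b\neq b'$ in $B$. Let $L\subset\mathbb{Z}$ be finite with $0\in L$ and let $(\alpha_l)_{l\in L}$ be complex numbers such that (i) $\alpha_0=1$; (ii) the matrix $T=\frac1{\sqrt N}\left(e^{2\pi i lb/R}\alpha_l\right)_{l\in L,\,b\in B}$ satisfies $T^*T=I_N$. Write $m_B(x)=\frac1N\sum_{b\in B}e^{2\pi i bx}$, $g_l(t)=(t-l)/R$ and $e_t(x)=e^{2\pi i tx}$. A set $M\subset\mathbb{R}$ is called invariant if $g_l(t)\in M$ whenever $t\in M$, $l\in L$ and $\alpha_l m_B(g_l(t))\neq0$. A finite minimal invariant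 set is a finite set that is minimal, with respect to inclusion, among the nonempty invariant sets. Let $\Omega(L)$ consist of the empty word and all finite words $l_0\dots l_k$ with $l_i\in L$ and $l_k\ne0$, and consider the family, indexed by $\Omega(L)$, $$\mathcal F=\left\{\Big(\prod_{i=0}^k\alpha_{l_i}\Big)e_{l_0+Rl_1+\dots+R^kl_k} : l_0\dots l_k\in\Omega(L)\right\}\subset L^2(\mu),$$ where the empty word gives the constant function $1$. (a) If $\{0\}$ is the only finite minimal invariant set, then the following condition holds: (iii) the only entire function $h$ on $\mathbb{C}$ such that $0\le h\le1$ on $\mathbb{R}$, $h(0)=1$ and $\sum_{l\in L}|\alpha_l|^2|m_B(g_l(t))|^2h(g_l(t))=h(t)$ for all $t\in\mathbb{R}$ is the constant function $1$; moreover, $\mathcal F$ is a Parseval frame for $L^2(\mu)$, that is, $\sum_{v\in\mathcal F}|\langle f,v\rangle|^2=\|f\|^2$ for all $f\in L^2(\mu)$, the sum being taken over the index set $\Omega(L)$. (b) Conversely, if $M\neq\{0\}$ is a finite minimal invariant set, then for every $c\in M$ the function $e_c$ is orthogonal to every element of $\mathcal F$ in $L^2(\mu)$; in particular, $\mathcal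 F$ is incomplete, i.e. its closed linear span is not $L^2(\mu)$. -/

import Mathlib

open MeasureTheory
open scoped ENNReal Matrix InnerProductSpace

noncomputable section

namespace WeightedFourier

/-- The maps `τ_b(x) = (x + b) / R` of the affine iterated function system. -/
def tau (R b : ℤ) (x : ℝ) : ℝ := (x + b) / R

/-- `μ` is a Borel probability measure with `μ(E) = (1/N) ∑_{b ∈ B} μ(τ_b⁻¹(E))`, `N = |B|`. -/
structure IsSelfAffineMeasure (R : ℤ) (B : Finset ℤ) (μ : Measure ℝ) : Prop where
  isProbabilityMeasure : IsProbabilityMeasure μ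
  invariance : ∀ E : Set ℝ, MeasurableSet E →
    μ E = (B.card : ℝ≥0∞)⁻¹ * ∑ b ∈ B, μ (tau R b ⁻¹' E)

open Classical in
/-- The self-affine measure `μ(R, B)`: the unique probability measure satisfying the invariance
equation. It exists and is unique when `|R| ≥ 2` and `B` is nonempty, see
`isSelfAffineMeasure_selfAffineMeasure` and `IsSelfAffineMeasure.eq_selfAffineMeasure`. -/
def selfAffineMeasure (R : ℤ) (B : Finset ℤ) : Measure ℝ :=
  if h : ∃ μ : Measure ℝ, IsSelfAffineMeasure R B μ then h.choose else 0

instance isFiniteMeasure_selfAffineMeasure (R : ℤ) (B : Finset ℤ) :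
    IsFiniteMeasure (selfAffineMeasure R B) := by
  unfold selfAffineMeasure
  split_ifs with h
  · have := h.choose_spec.isProbabilityMeasure
    infer_instance
  · infer_instance

section Existence

/-- The point of the attractor with digits `b`. -/
def coding (R : ℤ) (B : Finset ℤ) (b : ℕ → B) : ℝ := ∑' k, ((b k : ℤ) : ℝ) / (R : ℝ) ^ (k + 1)

lemma exists_digit_bound {R : ℤ} (hR : 2 ≤ |R|) (B : Finset ℤ) :
    ∃ u : ℕ → ℝ, Summable u ∧
      ∀ (k : ℕ) (b : B), ‖((b : ℤ) : ℝ) / (R : ℝ) ^ (k + 1)‖ ≤ u k := by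
  refine ⟨fun k => (∑ b ∈ B, |(b : ℝ)|) * (1 / 2 : ℝ) ^ (k + 1), ?_, ?_⟩
  · exact ((summable_nat_add_iff 1).2 summable_geometric_two).mul_left _
  · intro k b
    have h1 : |((b : ℤ) : ℝ)| ≤ ∑ b ∈ B, |(b : ℝ)| :=
      Finset.single_le_sum (f := fun b : ℤ => |(b : ℝ)|) (fun _ _ => abs_nonneg _) b.2
    have h2 : (2 : ℝ) ≤ |(R : ℝ)| := by exact_mod_cast hR
    change _ ≤ (∑ b ∈ B, |(b : ℝ)|) * (1 / 2 : ℝ) ^ (k + 1)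
    rw [norm_div, norm_pow, Real.norm_eq_abs, Real.norm_eq_abs, one_div, inv_pow, div_eq_mul_inv]
    gcongr

lemma summable_digits {R : ℤ} (hR : 2 ≤ |R|) (B : Finset ℤ) (b : ℕ → B) :
    Summable fun k => ((b k : ℤ) : ℝ) / (R : ℝ) ^ (k + 1) := by
  obtain ⟨u, hu, h⟩ := exists_digit_bound hR B
  exact Summable.of_norm_bounded hu fun k => h k (b k)

lemma continuous_coding {R : ℤ} (hR : 2 ≤ |R|) (B : Finset ℤ) : Continuous (coding R B) := by
  obtain ⟨u, hu, h⟩ := exists_digit_bound hR B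
  refine continuous_tsum (fun k => ?_) hu fun k b => h k (b k)
  exact (continuous_of_discreteTopology (f := fun c : B => ((c : ℤ) : ℝ) / (R : ℝ) ^ (k + 1))).comp
    (continuous_apply k)

/-- Prepend a digit to a sequence of digits. -/
def consDigit {B : Finset ℤ} (c : B) (b : ℕ → B) : ℕ → B
  | 0 => c
  | k + 1 => b k

lemma measurable_consDigit {B : Finset ℤ} (c : B) : Measurable (consDigit c) := by
  refine measurable_pi_lambda _ fun k => ?_
  cases k with
  | zero => exact measurable_const
  | succ k => exact measurable_pi_apply k

lemma coding_consDigit {R : ℤ} (hR : 2 ≤ |R|) {B : Finset ℤ} (c : B) (b : ℕ → B) :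
    coding R B (consDigit c b) = tau R c (coding R B b) := by
  have hR0 : (R : ℝ) ≠ 0 := by
    rintro h
    have : R = 0 := by exact_mod_cast h
    simp [this] at hR
  have h := (summable_digits hR B (consDigit c b)).tsum_eq_zero_add
  unfold coding tau
  rw [h, add_div, ← tsum_div_const, add_comm]
  congr 1
  · refine tsum_congr fun k => ?_
    simp only [consDigit]
    rw [div_div, ← pow_succ]
  · simp [consDigit]

/-- The uniform distribution on `B`. -/
def digitMeasure (B : Finset ℤ) : Measure B :=
  (B.card : ℝ≥0∞)⁻¹ • ∑ b : B, Measure.dirac b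

lemma isProbabilityMeasure_digitMeasure {B : Finset ℤ} (hB : B.Nonempty) :
    IsProbabilityMeasure (digitMeasure B) := by
  constructor
  have : (B.card : ℝ≥0∞) ≠ 0 := by simpa using hB.ne_empty
  simp [digitMeasure, ENNReal.inv_mul_cancel this (ENNReal.natCast_ne_top _)]

lemma infinitePi_consDigit {B : Finset ℤ} [IsProbabilityMeasure (digitMeasure B)] :
    (B.card : ℝ≥0∞)⁻¹ •
      ∑ c : B, (Measure.infinitePi fun _ : ℕ => digitMeasure B).map (consDigit c) =
    Measure.infinitePi fun _ : ℕ => digitMeasure B := by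
  classical
  refine Measure.eq_infinitePi _ fun s t ht => ?_
  obtain ⟨n, hn⟩ : ∃ n, s ⊆ Finset.range (n + 1) :=
    ⟨s.sup id, fun i hi => Finset.mem_range.2 (Nat.lt_succ_of_le (Finset.le_sup (f := id) hi))⟩
  set t' : ℕ → Set B := fun i => if i ∈ s then t i else Set.univ with ht'
  have hm : ∀ i, MeasurableSet (t' i) := fun i => Set.Finite.measurableSet (Set.toFinite _)
  have hpi : Set.pi (s : Set ℕ) t = Set.pi (Finset.range (n + 1) : Set ℕ) t' := by
    ext x
    simp only [Set.mem_pi, ht', Finset.mem_coe]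
    constructor
    · intro h i _
      split_ifs with hi
      · exact h i hi
      · trivial
    · intro h i hi
      have := h i (hn hi)
      rwa [if_pos hi] at this
  have hprod : ∏ i ∈ s, digitMeasure B (t i) =
      ∏ i ∈ Finset.range (n + 1), digitMeasure B (t' i) := by
    rw [← Finset.prod_subset hn (f := fun i => digitMeasure B (t' i))]
    · exact Finset.prod_congr rfl fun i hi => by simp [ht', hi]
    · intro i _ hi
      simp [ht', hi]
  have hpre : ∀ c : B, (Measure.infinitePi fun _ : ℕ => digitMeasure B).map (consDigit c)
      (Set.pi (Finset.range (n + 1) : Set ℕ) t') =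
      Measure.dirac c (t' 0) * ∏ i ∈ Finset.range n, digitMeasure B (t' (i + 1)) := by
    intro c
    rw [Measure.map_apply (measurable_consDigit c)
      (MeasurableSet.pi (Finset.countable_toSet _) fun i _ => hm i),
      Measure.dirac_apply' _ (hm 0)]
    by_cases hc : c ∈ t' 0
    · have : consDigit c ⁻¹' Set.pi (Finset.range (n + 1) : Set ℕ) t' =
          Set.pi (Finset.range n : Set ℕ) fun i => t' (i + 1) := by
        ext x
        simp only [Set.mem_preimage, Set.mem_pi, Finset.mem_coe, Finset.mem_range]
        constructor
        · intro h i hi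
          exact h (i + 1) (by omega)
        · rintro h (_ | i) hi
          · exact hc
          · exact h i (by omega)
      rw [this, Measure.infinitePi_pi _ fun i _ => hm (i + 1)]
      simp [hc]
    · have : consDigit c ⁻¹' Set.pi (Finset.range (n + 1) : Set ℕ) t' = ∅ := by
        ext x
        simp only [Set.mem_preimage, Set.mem_pi, Finset.mem_coe, Finset.mem_range,
          Set.mem_empty_iff_false, iff_false]
        exact fun h => hc (h 0 (by omega))
      rw [this]
      simp [hc]
  rw [hpi, hprod, Finset.prod_range_succ', Measure.smul_apply, Measure.finsetSum_apply,
    Finset.sum_congr rfl fun c _ => hpre c, ← Finset.sum_mul, smul_eq_mul, ← mul_assoc, mul_comm]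
  congr 1
  simp only [digitMeasure, Measure.smul_apply, Measure.finsetSum_apply, smul_eq_mul]

lemma exists_isSelfAffineMeasure {R : ℤ} (hR : 2 ≤ |R|) {B : Finset ℤ} (hB : B.Nonempty) :
    ∃ μ : Measure ℝ, IsSelfAffineMeasure R B μ := by
  have := isProbabilityMeasure_digitMeasure hB
  have hm : Measurable (coding R B) := (continuous_coding hR B).measurable
  have ht : ∀ c, Measurable (tau R c) := fun c => by unfold tau; fun_prop
  refine ⟨(Measure.infinitePi fun _ : ℕ => digitMeasure B).map (coding R B),
    Measure.isProbabilityMeasure_map hm.aemeasurable, fun E hE => ?_⟩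
  conv_lhs => rw [← infinitePi_consDigit, Measure.map_apply hm hE]
  rw [Measure.smul_apply, Measure.finsetSum_apply, smul_eq_mul, ← Finset.sum_coe_sort B]
  congr 1
  refine Finset.sum_congr rfl fun c _ => ?_
  rw [Measure.map_apply (measurable_consDigit c) (hm hE), Measure.map_apply hm (ht c hE)]
  congr 1
  ext b
  simp [coding_consDigit hR]

theorem isSelfAffineMeasure_selfAffineMeasure {R : ℤ} (hR : 2 ≤ |R|) {B : Finset ℤ}
    (hB : B.Nonempty) : IsSelfAffineMeasure R B (selfAffineMeasure R B) := by
  have h := exists_isSelfAffineMeasure hR hB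
  rw [selfAffineMeasure, dif_pos h]
  exact h.choose_spec

lemma IsSelfAffineMeasure.charFun_eq {R : ℤ} {B : Finset ℤ} {μ : Measure ℝ}
    (h : IsSelfAffineMeasure R B μ) (t : ℝ) :
    charFun μ t = ((B.card : ℂ)⁻¹ * ∑ b ∈ B, Complex.exp (t * b / R * Complex.I)) *
      charFun μ (t / R) := by
  have := h.isProbabilityMeasure
  have ht : ∀ c, Measurable (tau R c) := fun c => by unfold tau; fun_prop
  have hμ : μ = (B.card : ℝ≥0∞)⁻¹ • ∑ b ∈ B, μ.map (tau R b) := by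
    ext E hE
    rw [h.invariance E hE, Measure.smul_apply, Measure.finsetSum_apply, smul_eq_mul]
    congr 1
    exact Finset.sum_congr rfl fun b _ => (Measure.map_apply (ht b) hE).symm
  have hint : ∀ b ∈ B, Integrable (fun x : ℝ => Complex.exp (t * x * Complex.I))
      (μ.map (tau R b)) := by
    intro b _
    have := Measure.isProbabilityMeasure_map (μ := μ) (ht b).aemeasurable
    refine Integrable.of_bound (C := 1) (by fun_prop) (Filter.Eventually.of_forall fun x => ?_)
    rw [← Complex.ofReal_mul, Complex.norm_exp_ofReal_mul_I]
  rw [charFun_apply_real, charFun_apply_real]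
  conv_lhs => rw [hμ]
  rw [integral_smul_measure, integral_finsetSum_measure hint]
  simp only [ENNReal.toReal_inv, ENNReal.toReal_natCast]
  rw [mul_assoc, Finset.sum_mul, Complex.real_smul]
  push_cast
  congr 1
  refine Finset.sum_congr rfl fun b _ => ?_
  rw [integral_map (ht b).aemeasurable (by fun_prop), ← integral_const_mul]
  congr 1
  ext x
  rw [← Complex.exp_add]
  congr 1
  simp only [tau]
  push_cast
  ring

theorem IsSelfAffineMeasure.unique {R : ℤ} (hR : 2 ≤ |R|) {B : Finset ℤ} {μ ν : Measure ℝ}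
    (hμ : IsSelfAffineMeasure R B μ) (hν : IsSelfAffineMeasure R B ν) : μ = ν := by
  have := hμ.isProbabilityMeasure
  have := hν.isProbabilityMeasure
  have h2 : (2 : ℝ) ≤ |(R : ℝ)| := by exact_mod_cast hR
  refine Measure.ext_of_charFun (funext fun t => ?_)
  set d : ℝ → ℝ := fun t => ‖charFun μ t - charFun ν t‖ with hd
  have hle : ∀ t, d t ≤ d (t / R) := by
    intro t
    simp only [hd]
    rw [hμ.charFun_eq t, hν.charFun_eq t, ← mul_sub, norm_mul]
    refine mul_le_of_le_one_left (norm_nonneg _) ?_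
    rw [norm_mul, norm_inv, Complex.norm_natCast]
    have hs : ‖∑ b ∈ B, Complex.exp (t * b / R * Complex.I)‖ ≤ B.card := by
      refine (norm_sum_le _ _).trans ?_
      rw [Finset.card_eq_sum_ones, Nat.cast_sum]
      refine Finset.sum_le_sum fun b _ => ?_
      have : (t * b / R * Complex.I : ℂ) = ((t * b / R : ℝ) : ℂ) * Complex.I := by push_cast; rfl
      rw [this, Complex.norm_exp_ofReal_mul_I, Nat.cast_one]
    rcases Nat.eq_zero_or_pos B.card with h0 | h0
    · simp [h0]
    · rw [inv_mul_le_iff₀ (by exact_mod_cast h0), mul_one]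
      exact hs
  have hit : ∀ n : ℕ, d t ≤ d (t / (R : ℝ) ^ n) := by
    intro n
    induction n with
    | zero => simp
    | succ n ih =>
      refine ih.trans ((hle _).trans_eq ?_)
      rw [div_div, ← pow_succ]
  have hcont : Continuous d := by
    have h1 : Continuous (charFun μ) := by fun_prop
    have h2 : Continuous (charFun ν) := by fun_prop
    exact (h1.sub h2).norm
  have hlim : Filter.Tendsto (fun n : ℕ => t / (R : ℝ) ^ n) Filter.atTop (nhds 0) := by
    have : Filter.Tendsto (fun n : ℕ => t * ((R : ℝ)⁻¹) ^ n) Filter.atTop (nhds (t * 0)) := by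
      refine (tendsto_pow_atTop_nhds_zero_of_abs_lt_one ?_).const_mul t
      rw [abs_inv]
      exact inv_lt_one_of_one_lt₀ (by linarith)
    simpa [div_eq_mul_inv] using this
  have h0 : d 0 = 0 := by simp [hd]
  have hfin : d t ≤ 0 := by
    have := (hcont.tendsto 0).comp hlim
    rw [h0] at this
    exact ge_of_tendsto' this hit
  exact sub_eq_zero.1 (norm_le_zero_iff.1 hfin)

theorem IsSelfAffineMeasure.eq_selfAffineMeasure {R : ℤ} (hR : 2 ≤ |R|) {B : Finset ℤ}
    (hB : B.Nonempty) {μ : Measure ℝ} (hμ : IsSelfAffineMeasure R B μ) :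
    μ = selfAffineMeasure R B :=
  hμ.unique hR (isSelfAffineMeasure_selfAffineMeasure hR hB)

end Existence

/-- The attractor `X_B = {∑_{k ≥ 1} R⁻ᵏ b_k : b_k ∈ B}`. -/
def attractor (R : ℤ) (B : Finset ℤ) : Set ℝ :=
  {x | ∃ b : ℕ → ℤ, (∀ k, b k ∈ B) ∧ HasSum (fun k => (b k : ℝ) / (R : ℝ) ^ (k + 1)) x}

/-- The no overlap condition: `μ(τ_b(X_B) ∩ τ_{b'}(X_B)) = 0` for `b ≠ b'` in `B`. -/
def NoOverlap (R : ℤ) (B : Finset ℤ) : Prop :=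
  ∀ b ∈ B, ∀ b' ∈ B, b ≠ b' →
    selfAffineMeasure R B (tau R b '' attractor R B ∩ tau R b' '' attractor R B) = 0

/-- `m_B(x) = (1/N) ∑_{b ∈ B} e^{2πi b x}`. -/
def mB (B : Finset ℤ) (x : ℝ) : ℂ :=
  (1 / (B.card : ℂ)) * ∑ b ∈ B, Complex.exp (2 * Real.pi * Complex.I * b * x)

/-- The maps `g_l(t) = (t - l) / R`. -/
def g (R l : ℤ) (t : ℝ) : ℝ := (t - l) / R

/-- The matrix `T = N^{-1/2} (e^{2πi R⁻¹ l b} α_l)`, rows indexed by `L`, columns by `B`. -/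
def matT (R : ℤ) (B L : Finset ℤ) (α : ℤ → ℂ) : Matrix L B ℂ :=
  Matrix.of fun l b => (1 / (Real.sqrt B.card : ℂ)) *
    (Complex.exp (2 * Real.pi * Complex.I * ((l : ℤ) * (b : ℤ) / R)) * α l)

/-- `h` is entire, `0 ≤ h ≤ 1` on `ℝ`, `h(0) = 1`, and
`∑_{l ∈ L} |α_l|² |m_B(g_l(t))|² h(g_l(t)) = h(t)` for all real `t`. -/
structure IsHarmonic (R : ℤ) (B L : Finset ℤ) (α : ℤ → ℂ) (h : ℂ → ℂ) : Prop where
  entire : Differentiable ℂ h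
  real_on_reals : ∀ t : ℝ, (h t).im = 0
  bounds : ∀ t : ℝ, 0 ≤ (h t).re ∧ (h t).re ≤ 1
  at_zero : h 0 = 1
  fixed : ∀ t : ℝ,
    ∑ l ∈ L, ((‖α l‖ ^ 2 * ‖mB B (g R l t)‖ ^ 2 : ℝ) : ℂ) * h (g R l t : ℝ) = h t

/-- The only function as in `IsHarmonic` is the constant function `1`. -/
def OnlyConstantHarmonic (R : ℤ) (B L : Finset ℤ) (α : ℤ → ℂ) : Prop :=
  ∀ h : ℂ → ℂ, IsHarmonic R B L α h ↔ h = fun _ => 1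

/-- `M` is invariant: it contains every point `g_l(t)`, `t ∈ M`, `l ∈ L`, such that the
transition `t → g_l(t)` is possible, that is, `α_l m_B(g_l(t)) ≠ 0`. -/
def IsInvariant (R : ℤ) (B L : Finset ℤ) (α : ℤ → ℂ) (M : Set ℝ) : Prop :=
  ∀ t ∈ M, ∀ l ∈ L, α l * mB B (g R l t) ≠ 0 → g R l t ∈ M

/-- `M` is a finite minimal invariant set: finite, and minimal with respect to inclusion among
the nonempty invariant sets. -/
def IsFiniteMinimalInvariant (R : ℤ) (B L : Finset ℤ) (α : ℤ → ℂ) (M : Set ℝ) : Prop :=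
  M.Finite ∧ Minimal (fun S : Set ℝ => S.Nonempty ∧ IsInvariant R B L α S) M

/-- `Ω(L)`: the empty word and the finite words with digits in `L` whose last digit is not `0`. -/
def Words (L : Finset ℤ) : Type :=
  {w : List ℤ // (∀ l ∈ w, l ∈ L) ∧ ∀ l ∈ w.getLast?, l ≠ 0}

/-- The frequency `l₀ + R l₁ + ⋯ + Rᵏ l_k` of the word `l₀ l₁ … l_k`; `0` for the empty word. -/
def freq (R : ℤ) : List ℤ → ℤ
  | [] => 0
  | l :: w => l + R * freq R w

/-- The exponential `e_t(x) = e^{2πi t x}` as an element of `L²(μ)`. -/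
def expL2 (μ : Measure ℝ) [IsFiniteMeasure μ] (t : ℝ) : Lp ℂ 2 μ :=
  MemLp.toLp (fun x : ℝ => Complex.exp (2 * Real.pi * Complex.I * t * x))
    (MemLp.of_bound (by fun_prop) 1 (Filter.Eventually.of_forall fun x => by
      have : (2 * Real.pi * Complex.I * t * x : ℂ) =
          ((2 * Real.pi * t * x : ℝ) : ℂ) * Complex.I := by push_cast; ring
      rw [this, Complex.norm_exp_ofReal_mul_I]))

/-- The weighted exponentials `(∏ α_{l_i}) e_{l₀ + R l₁ + ⋯ + Rᵏ l_k}` in `L²(μ(R, B))`, indexed by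
the words in `Ω(L)`; the empty word gives the constant function `1`. -/
def weightedExp (R : ℤ) (B L : Finset ℤ) (α : ℤ → ℂ) (w : Words L) :
    Lp ℂ 2 (selfAffineMeasure R B) :=
  (w.1.map α).prod • expL2 (selfAffineMeasure R B) (freq R w.1 : ℝ)

/-- A Parseval frame: a frame with both frame bounds `1`. -/
def IsParsevalFrame {ι H : Type*} [NormedAddCommGroup H] [InnerProductSpace ℂ H]
    (v : ι → H) : Prop :=
  ∀ f : H, HasSum (fun i => ‖inner ℂ (v i) f‖ ^ 2) (‖f‖ ^ 2)

end WeightedFourier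

end

/-!
The relation `T* T = 1` says that the transfer operators of the digits `l ∈ L` satisfy
`∑_l ‖S_l f‖² = ‖f‖²`. Peeling off one letter of a word at a time, it follows that the weighted
exponentials `v_w` form a Bessel family with bound `1`, so that their analysis operator is a
contraction. Since `μ` has bounded support, `t ↦ e_t` is analytic, and hence so is the energy
`t ↦ ∑_w |⟨v_w, e_t⟩|²`, which is at most `1`, equal to `1` at `0`, and harmonic for the random walk
`t → g_l(t)`. The points where an analytic harmonic function attains its minimum on an interval
preserved by all `g_l` form an invariant set; if `{0}` is the only finite minimal invariant set,
this set contains `0` or is infinite, and either way the function is constant. So the analysis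
operator preserves the norm of every `e_t`; being a contraction, it is isometric on their closed
span, which is all of `L²(μ)`.

If `M ≠ {0}` is a finite minimal invariant set, then `0 ∉ M`, and self-similarity of `μ` reduces
`⟨v_w, e_c⟩`, for `c ∈ M`, to `⟨1, e_d⟩` with `d ∈ M`, and this to `⟨1, e_{d / Rⁿ}⟩` for all `n`. As
the points `d / Rⁿ` cannot all lie in `M`, some factor vanishes on the way.
-/

noncomputable section

open scoped ComplexConjugate ContDiff

namespace WeightedFourier

/-! ### Isometries, Bessel families and Parseval frames -/

section Hilbert

variable {𝕜 : Type*} [RCLike 𝕜]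

lemma sum_norm_sq_mulVec {m n : Type*} [Fintype m] [Fintype n] [DecidableEq n]
    {A : Matrix m n 𝕜} (hA : Aᴴ * A = 1) (v : n → 𝕜) :
    ∑ i, ‖(A *ᵥ v) i‖ ^ 2 = ∑ j, ‖v j‖ ^ 2 := by
  have h : star (A *ᵥ v) ⬝ᵥ (A *ᵥ v) = star v ⬝ᵥ v := by
    rw [Matrix.star_mulVec, Matrix.dotProduct_mulVec, Matrix.vecMul_vecMul, hA, Matrix.vecMul_one]
  simp only [dotProduct, Pi.star_apply, RCLike.star_def, RCLike.conj_mul] at h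
  exact_mod_cast h

variable {ι H K : Type*} [NormedAddCommGroup H] [InnerProductSpace 𝕜 H]
  [NormedAddCommGroup K] [InnerProductSpace 𝕜 K]

lemma topologicalClosure_span_ne_top {v : ι → H} {x : H} (hx : x ≠ 0)
    (h : ∀ i, inner 𝕜 (v i) x = 0) :
    (Submodule.span 𝕜 (Set.range v)).topologicalClosure ≠ ⊤ := by
  intro htop
  have hspan : Submodule.span 𝕜 (Set.range v) ≤ (𝕜 ∙ x)ᗮ :=
    Submodule.span_le.2 <| Set.range_subset_iff.2 fun i =>
      Submodule.mem_orthogonal_singleton_iff_inner_left.2 (h i)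
  have hx' : x ∈ (𝕜 ∙ x)ᗮ :=
    Submodule.topologicalClosure_minimal _ hspan (Submodule.isClosed_orthogonal _)
      (htop ▸ Submodule.mem_top)
  exact hx (inner_self_eq_zero.1 (Submodule.mem_orthogonal_singleton_iff_inner_left.1 hx'))

variable [CompleteSpace H] [CompleteSpace K]

lemma adjoint_apply_apply_eq_self {T : H →L[𝕜] K} (hT : ‖T‖ ≤ 1) {x : H} (hx : ‖T x‖ = ‖x‖) :
    T.adjoint (T x) = x := by
  have hle : ‖T.adjoint (T x)‖ ≤ ‖x‖ := by
    rw [← hx]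
    exact T.adjoint.le_of_opNorm_le_of_le (by rwa [LinearIsometryEquiv.norm_map]) le_rfl |>.trans
      (one_mul _).le
  have hsub : ‖T.adjoint (T x) - x‖ ^ 2 ≤ 0 := by
    rw [norm_sub_sq (𝕜 := 𝕜), ContinuousLinearMap.adjoint_inner_left, inner_self_eq_norm_sq, hx]
    nlinarith [norm_nonneg (T.adjoint (T x))]
  exact sub_eq_zero.1 (norm_eq_zero.1 (sq_nonpos_iff _ |>.1 hsub))

lemma norm_apply_eq_of_dense_span {T : H →L[𝕜] K} (hT : ‖T‖ ≤ 1) {D : Set H}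
    (hD : Dense (Submodule.span 𝕜 D : Set H)) (h : ∀ d ∈ D, ‖T d‖ = ‖d‖) (x : H) :
    ‖T x‖ = ‖x‖ := by
  have hadj : T.adjoint ∘L T = 1 :=
    ContinuousLinearMap.ext_on hD fun d hd => adjoint_apply_apply_eq_self hT (h d hd)
  exact T.norm_map_iff_adjoint_comp_self.2 hadj x

end Hilbert

section Bessel

variable {ι H : Type*} [NormedAddCommGroup H] [InnerProductSpace ℂ H]

/-- A Bessel family with bound `1`: Bessel's inequality holds for all finite partial sums. -/
def IsBessel (v : ι → H) : Prop :=
  ∀ (f : H) (s : Finset ι), ∑ i ∈ s, ‖inner ℂ (v i) f‖ ^ 2 ≤ ‖f‖ ^ 2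

/-- The analysis operator `f ↦ (⟨v i, f⟩)_i` of a Bessel family. -/
def IsBessel.analysisOp {v : ι → H} (hv : IsBessel v) : H →L[ℂ] lp (fun _ : ι => ℂ) 2 :=
  LinearMap.mkContinuous
    { toFun := fun f => ⟨fun i => inner ℂ (v i) f, memℓp_gen' (C := ‖f‖ ^ 2) fun s => by
        simpa using hv f s⟩
      map_add' := fun f g => by ext i; exact inner_add_right _ _ _
      map_smul' := fun c f => by ext i; exact inner_smul_right _ _ _ } 1 fun f => by
    rw [one_mul]
    refine lp.norm_le_of_forall_sum_le (by norm_num) (norm_nonneg _) fun s => ?_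
    simpa using hv f s

lemma IsBessel.norm_analysisOp_le {v : ι → H} (hv : IsBessel v) : ‖hv.analysisOp‖ ≤ 1 :=
  LinearMap.mkContinuous_norm_le _ zero_le_one _

lemma IsBessel.hasSum_norm_inner_sq {v : ι → H} (hv : IsBessel v) (f : H) :
    HasSum (fun i => ‖inner ℂ (v i) f‖ ^ 2) (‖hv.analysisOp f‖ ^ 2) := by
  have h := lp.hasSum_norm (p := 2) (by norm_num) (hv.analysisOp f)
  simp only [ENNReal.toReal_ofNat, Real.rpow_ofNat] at h
  exact h

lemma IsBessel.isParsevalFrame [CompleteSpace H] {v : ι → H} (hv : IsBessel v) {D : Set H}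
    (hD : Dense (Submodule.span ℂ D : Set H))
    (h : ∀ d ∈ D, ∑' i, ‖inner ℂ (v i) d‖ ^ 2 = ‖d‖ ^ 2) : IsParsevalFrame v := by
  intro f
  have hnorm : ∀ d ∈ D, ‖hv.analysisOp d‖ = ‖d‖ := fun d hd => by
    rw [← sq_eq_sq₀ (norm_nonneg _) (norm_nonneg _), ← h d hd, (hv.hasSum_norm_inner_sq d).tsum_eq]
  rw [← norm_apply_eq_of_dense_span hv.norm_analysisOp_le hD hnorm f]
  exact hv.hasSum_norm_inner_sq f

end Bessel

/-! ### Exponentials -/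

/-- The exponential `e_t(x) = e^{2πi t x}`. -/
def expo (t x : ℝ) : ℂ := Real.fourierChar (t * x)

lemma expo_eq_exp (t x : ℝ) : expo t x = Complex.exp (2 * Real.pi * Complex.I * t * x) := by
  rw [expo, Real.fourierChar_apply]
  push_cast
  ring_nf

@[simp] lemma norm_expo (t x : ℝ) : ‖expo t x‖ = 1 := Circle.norm_coe _

@[simp] lemma expo_zero_left (x : ℝ) : expo 0 x = 1 := by simp [expo]

lemma conj_expo (t x : ℝ) : conj (expo t x) = expo (-t) x := by
  rw [expo, expo, neg_mul, AddChar.map_neg_eq_inv, Circle.coe_inv_eq_conj]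

lemma expo_add_left (s t x : ℝ) : expo (s + t) x = expo s x * expo t x := by
  rw [expo, add_mul, AddChar.map_add_eq_mul, Circle.coe_mul, expo, expo]

lemma expo_add_right (t x y : ℝ) : expo t (x + y) = expo t x * expo t y := by
  rw [expo, mul_add, AddChar.map_add_eq_mul, Circle.coe_mul, expo, expo]

lemma expo_tau (R b : ℤ) (t x : ℝ) : expo t (tau R b x) = expo (t / R) x * expo (t / R) b := by
  rw [← expo_add_right, expo, expo, tau, div_mul_eq_mul_div, mul_div_assoc]

lemma expo_intCast (m n : ℤ) : expo m n = 1 := by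
  rw [expo_eq_exp, Complex.exp_eq_one_iff]
  exact ⟨m * n, by push_cast; ring⟩

lemma continuous_expo (t : ℝ) : Continuous (expo t) := by
  unfold expo
  fun_prop

lemma mB_eq_sum_expo (B : Finset ℤ) (x : ℝ) :
    mB B x = (B.card : ℂ)⁻¹ * ∑ b ∈ B, expo x b := by
  simp only [mB, one_div, expo_eq_exp, Complex.ofReal_intCast, mul_right_comm _ (x : ℂ)]

lemma mB_zero {B : Finset ℤ} (hB : B.Nonempty) : mB B 0 = 1 := by
  simp [mB_eq_sum_expo, hB.ne_empty]

section Lp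

variable (μ : Measure ℝ) [IsFiniteMeasure μ]

lemma memLp_expo (t : ℝ) (p : ℝ≥0∞) : MemLp (expo t) p μ :=
  MemLp.of_bound (continuous_expo t).aestronglyMeasurable 1
    (ae_of_all _ fun x => (norm_expo t x).le)

lemma coeFn_expL2 (t : ℝ) : expL2 μ t =ᵐ[μ] expo t := by
  rw [funext (expo_eq_exp t)]
  exact MemLp.coeFn_toLp _

lemma inner_expL2 (t : ℝ) (f : Lp ℂ 2 μ) : inner ℂ (expL2 μ t) f = ∫ x, expo (-t) x * f x ∂μ := by
  rw [L2.inner_def]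
  refine integral_congr_ae ?_
  filter_upwards [coeFn_expL2 μ t] with x hx
  rw [hx, RCLike.inner_apply, conj_expo, mul_comm]

end Lp

lemma integrable_expo_mul {μ : Measure ℝ} {f : ℝ → ℂ} (hf : Integrable f μ) (t : ℝ) :
    Integrable (fun x => expo t x * f x) μ :=
  hf.bdd_mul (c := 1) (continuous_expo t).aestronglyMeasurable (ae_of_all _ fun x => by simp)

lemma norm_sq_Lp_two {X E : Type*} [MeasurableSpace X] {μ : Measure X} [NormedAddCommGroup E]
    (f : Lp E 2 μ) : ‖f‖ ^ 2 = ∫ x, ‖f x‖ ^ 2 ∂μ := by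
  rw [Lp.norm_def, (Lp.memLp f).eLpNorm_eq_integral_rpow_norm two_ne_zero ENNReal.ofNat_ne_top,
    ENNReal.toReal_ofReal (by positivity), ← Real.rpow_mul_natCast (by positivity)]
  simp

lemma norm_expL2 (μ : Measure ℝ) [IsProbabilityMeasure μ] (t : ℝ) : ‖expL2 μ t‖ = 1 := by
  have h : ‖expL2 μ t‖ ^ 2 = 1 := by
    rw [norm_sq_Lp_two, integral_congr_ae (g := fun _ => 1)]
    · simp
    · filter_upwards [coeFn_expL2 μ t] with x hx
      simp [hx]
  exact (pow_eq_one_iff_of_nonneg (norm_nonneg _) two_ne_zero).1 h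

/-! ### Integration against a self-affine measure -/

lemma norm_integral_sq_le {Ω E : Type*} [MeasurableSpace Ω] {μ : Measure Ω}
    [IsProbabilityMeasure μ] [NormedAddCommGroup E] [NormedSpace ℝ E] {f : Ω → E}
    (hf : MemLp f 2 μ) : ‖∫ x, f x ∂μ‖ ^ 2 ≤ ∫ x, ‖f x‖ ^ 2 ∂μ := by
  have hvar := ProbabilityTheory.variance_nonneg (fun x => ‖f x‖) μ
  rw [ProbabilityTheory.variance_eq_sub hf.norm, sub_nonneg] at hvar
  exact (pow_le_pow_left₀ (norm_nonneg _) (norm_integral_le_integral_norm f) 2).trans hvar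

variable {R : ℤ} {B L : Finset ℤ} {α : ℤ → ℂ} {μ : Measure ℝ}

lemma continuous_tau (R b : ℤ) : Continuous (tau R b) := by
  unfold tau
  fun_prop

lemma max_abs_tau_sub_le (hR : 2 ≤ |R|) {b : ℤ} {C : ℝ} (hb : |(b : ℝ)| ≤ C) (x : ℝ) :
    max (|tau R b x| - C) 0 ≤ max (|x| - C) 0 / 2 := by
  have hR2 : (2 : ℝ) ≤ |(R : ℝ)| := by exact_mod_cast hR
  have hC : 0 ≤ C := (abs_nonneg _).trans hb
  have hx : |tau R b x| ≤ (|x| + C) / 2 := by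
    rw [tau, abs_div]
    gcongr
    exact (abs_add_le x b).trans (by gcongr)
  have hdist : |x| - C ≤ max (|x| - C) 0 := le_max_left _ _
  exact max_le (by linarith) (by positivity)

namespace IsSelfAffineMeasure

lemma eq_smul_sum_map (h : IsSelfAffineMeasure R B μ) :
    μ = (B.card : ℝ≥0∞)⁻¹ • ∑ b ∈ B, μ.map (tau R b) := by
  ext E hE
  simp only [Measure.smul_apply, Measure.finsetSum_apply, smul_eq_mul,
    Measure.map_apply (continuous_tau R _).measurable hE]
  exact h.invariance E hE

lemma map_tau_le (h : IsSelfAffineMeasure R B μ) {b : ℤ} (hb : b ∈ B) :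
    μ.map (tau R b) ≤ (B.card : ℝ≥0∞) • μ := by
  have hN : (B.card : ℝ≥0∞) ≠ 0 := by simpa using Finset.ne_empty_of_mem hb
  conv_rhs => rw [h.eq_smul_sum_map, smul_smul, ENNReal.mul_inv_cancel hN (by simp), one_smul]
  exact Finset.single_le_sum (f := fun b => μ.map (tau R b)) (fun _ _ => Measure.zero_le _) hb

lemma memLp_comp_tau {E : Type*} [NormedAddCommGroup E] (h : IsSelfAffineMeasure R B μ) {b : ℤ}
    (hb : b ∈ B) {p : ℝ≥0∞} {f : ℝ → E} (hf : MemLp f p μ) :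
    MemLp (fun x => f (tau R b x)) p μ :=
  (hf.of_measure_le_smul (by simp) (h.map_tau_le hb)).comp_of_map
    (continuous_tau R b).aemeasurable

lemma integral_eq {E : Type*} [NormedAddCommGroup E] [NormedSpace ℝ E]
    (h : IsSelfAffineMeasure R B μ) {f : ℝ → E} (hf : Integrable f μ) :
    ∫ x, f x ∂μ = (B.card : ℝ)⁻¹ • ∑ b ∈ B, ∫ x, f (tau R b x) ∂μ := by
  have hint : ∀ b ∈ B, Integrable f (μ.map (tau R b)) := fun b hb =>
    hf.of_measure_le_smul (by simp) (h.map_tau_le hb)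
  conv_lhs => rw [h.eq_smul_sum_map]
  rw [integral_smul_measure, integral_finsetSum_measure hint, ENNReal.toReal_inv,
    ENNReal.toReal_natCast]
  congr 1
  exact Finset.sum_congr rfl fun b hb =>
    integral_map (continuous_tau R b).aemeasurable (hint b hb).aestronglyMeasurable

lemma integral_expo (h : IsSelfAffineMeasure R B μ) (t : ℝ) :
    ∫ x, expo t x ∂μ = mB B (t / R) * ∫ x, expo (t / R) x ∂μ := by
  have := h.isProbabilityMeasure
  rw [h.integral_eq ((memLp_expo μ t 1).integrable le_rfl), mB_eq_sum_expo, Complex.real_smul,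
    mul_assoc, Finset.sum_mul]
  simp only [expo_tau, integral_mul_const, mul_comm, Complex.ofReal_inv, Complex.ofReal_natCast]

/-- The integrals of `arctan ∘ d` and `arctan ∘ (d / 2)` agree, by invariance. -/
lemma ae_eq_zero_of_comp_tau_le_half (h : IsSelfAffineMeasure R B μ) {d : ℝ → ℝ}
    (hd : Continuous d) (hd0 : ∀ x, 0 ≤ d x) (hd_tau : ∀ b ∈ B, ∀ x, d (tau R b x) ≤ d x / 2) :
    d =ᵐ[μ] 0 := by
  have := h.isProbabilityMeasure
  have hint : ∀ {k : ℝ → ℝ}, Continuous k → Integrable (fun x => Real.arctan (k x)) μ :=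
    fun hk => .of_bound (Real.continuous_arctan.comp hk).aestronglyMeasurable (Real.pi / 2)
      (ae_of_all _ fun x => (abs_lt.2 ⟨Real.neg_pi_div_two_lt_arctan _,
        Real.arctan_lt_pi_div_two _⟩).le)
  have hle : ∫ x, Real.arctan (d x) ∂μ ≤ ∫ x, Real.arctan (d x / 2) ∂μ := by
    rw [h.integral_eq (hint hd), smul_eq_mul]
    have hnn : 0 ≤ ∫ x, Real.arctan (d x / 2) ∂μ :=
      integral_nonneg fun x => Real.arctan_nonneg.2 (by linarith [hd0 x])
    refine inv_mul_le_of_le_mul₀ (by positivity) hnn ?_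
    rw [← nsmul_eq_mul]
    exact Finset.sum_le_card_nsmul _ _ _ fun b hb =>
      integral_mono (hint (hd.comp (continuous_tau R b))) (hint (hd.div_const 2)) fun x =>
        Real.arctan_mono (hd_tau b hb x)
  have hnonneg : 0 ≤ fun x => Real.arctan (d x) - Real.arctan (d x / 2) := fun x =>
    sub_nonneg.2 (Real.arctan_mono (half_le_self (hd0 x)))
  have hzero : ∫ x, (Real.arctan (d x) - Real.arctan (d x / 2)) ∂μ = 0 :=
    le_antisymm (by rw [integral_sub (hint hd) (hint (hd.div_const 2))]; linarith)
      (integral_nonneg hnonneg)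
  filter_upwards [(integral_eq_zero_iff_of_nonneg hnonneg
    ((hint hd).sub (hint (hd.div_const 2)))).1 hzero] with x hx
  have hhalf : d x = d x / 2 := Real.arctan_injective (sub_eq_zero.1 hx)
  change d x = 0
  linarith

/-- Every `τ_b` at least halves the distance `max (|x| - C) 0` to `[-C, C]`, where `C = ∑ |b|`. -/
lemma ae_abs_le (hR : 2 ≤ |R|) (h : IsSelfAffineMeasure R B μ) :
    ∀ᵐ x ∂μ, |x| ≤ ∑ b ∈ B, |(b : ℝ)| := by
  set C := ∑ b ∈ B, |(b : ℝ)|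
  have hzero : (fun x => max (|x| - C) 0) =ᵐ[μ] 0 :=
    h.ae_eq_zero_of_comp_tau_le_half (by fun_prop) (fun x => le_max_right _ _) fun b hb x =>
      max_abs_tau_sub_le hR (Finset.single_le_sum (f := fun b : ℤ => |(b : ℝ)|)
        (fun _ _ => abs_nonneg _) hb) x
  filter_upwards [hzero] with x hx
  exact sub_nonpos.1 (max_eq_right_iff.1 hx)

end IsSelfAffineMeasure

/-! ### The transfer operators -/

/-- The operator `f ↦ conj α_l · (1/N) ∑_{b ∈ B} (e_{-l} f) ∘ τ_b`. In the absence of overlap it is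
the adjoint on `L²(μ)` of `f ↦ α_l e_l · (f ∘ 𝓡)`, with `𝓡` the common left inverse of the `τ_b`. -/
def transfer (R : ℤ) (B : Finset ℤ) (α : ℤ → ℂ) (l : ℤ) (f : ℝ → ℂ) (x : ℝ) : ℂ :=
  conj (α l) * ((B.card : ℂ)⁻¹ * ∑ b ∈ B, expo (-l) (tau R b x) * f (tau R b x))

/-- The probability `|α_l|² |m_B(g_l(t))|²` of the transition `t → g_l(t)`. -/
def transitionProb (R : ℤ) (B : Finset ℤ) (α : ℤ → ℂ) (l : ℤ) (t : ℝ) : ℝ :=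
  ‖α l‖ ^ 2 * ‖mB B (g R l t)‖ ^ 2

lemma transitionProb_nonneg (R : ℤ) (B : Finset ℤ) (α : ℤ → ℂ) (l : ℤ) (t : ℝ) :
    0 ≤ transitionProb R B α l t := by
  unfold transitionProb
  positivity

lemma transitionProb_eq_zero_iff {l : ℤ} {t : ℝ} :
    transitionProb R B α l t = 0 ↔ α l * mB B (g R l t) = 0 := by
  simp [transitionProb]

lemma norm_transfer (f : ℝ → ℂ) (x : ℝ) (l : L) :
    ‖transfer R B α l f x‖ =
      (√B.card)⁻¹ * ‖(matT R B L α *ᵥ fun b => conj (f (tau R b x))) l‖ := by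
  have hsq : (B.card : ℂ)⁻¹ = (√B.card : ℂ)⁻¹ * (√B.card : ℂ)⁻¹ := by
    rw [← mul_inv, ← Complex.ofReal_mul, Real.mul_self_sqrt B.card.cast_nonneg,
      Complex.ofReal_natCast]
  have hmat : ∀ b : B, matT R B L α l b = (√B.card : ℂ)⁻¹ * (expo (l / R) b * α l) := by
    intro b
    rw [matT, Matrix.of_apply, one_div, expo_eq_exp]
    push_cast
    ring_nf
  have hconj : conj (transfer R B α l f x) = expo (l / R) x * ((√B.card : ℂ)⁻¹ *
      (matT R B L α *ᵥ fun b => conj (f (tau R b x))) l) := by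
    have hterm : ∀ b : ℤ, conj (expo (-l) (tau R b x)) = expo (l / R) x * expo (l / R) b := by
      intro b
      rw [conj_expo, neg_neg, expo_tau]
    simp only [transfer, Matrix.mulVec, dotProduct, hmat, hterm, map_mul, map_sum, map_inv₀,
      Complex.conj_conj, Complex.conj_ofReal, hsq, Finset.mul_sum, ← Finset.sum_coe_sort B]
    exact Finset.sum_congr rfl fun b _ => by ring
  rw [← RCLike.norm_conj, hconj, norm_mul, norm_expo, one_mul, norm_mul, norm_inv,
    Complex.norm_of_nonneg (Real.sqrt_nonneg _)]

lemma sum_norm_sq_transfer (hT : (matT R B L α)ᴴ * matT R B L α = 1) (f : ℝ → ℂ) (x : ℝ) :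
    ∑ l ∈ L, ‖transfer R B α l f x‖ ^ 2 = (B.card : ℝ)⁻¹ * ∑ b ∈ B, ‖f (tau R b x)‖ ^ 2 := by
  rw [← Finset.sum_coe_sort L, ← Finset.sum_coe_sort B]
  simp only [norm_transfer, mul_pow, inv_pow, Real.sq_sqrt B.card.cast_nonneg, ← Finset.mul_sum,
    sum_norm_sq_mulVec hT, RCLike.norm_conj]

lemma transfer_expo (R : ℤ) (B : Finset ℤ) (α : ℤ → ℂ) (l : ℤ) (t x : ℝ) :
    transfer R B α l (expo t) x = conj (α l) * mB B (g R l t) * expo (g R l t) x := by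
  have hg : (-l + t) / R = g R l t := by rw [g, neg_add_eq_sub]
  have hterm : ∀ b, expo (-l) (tau R b x) * expo t (tau R b x) =
      expo (g R l t) x * expo (g R l t) b := fun b => by
    rw [← expo_add_left, expo_tau, hg]
  simp only [transfer, hterm, ← Finset.mul_sum, mB_eq_sum_expo]
  ring

lemma sum_transitionProb (hB : B.Nonempty) (hT : (matT R B L α)ᴴ * matT R B L α = 1) (t : ℝ) :
    ∑ l ∈ L, transitionProb R B α l t = 1 := by
  have h := sum_norm_sq_transfer hT (expo t) 0
  simpa [transfer_expo, mul_pow, transitionProb, hB.ne_empty] using h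

namespace IsSelfAffineMeasure

lemma memLp_transfer (h : IsSelfAffineMeasure R B μ) (α : ℤ → ℂ) (l : ℤ) {p : ℝ≥0∞} {f : ℝ → ℂ}
    (hf : MemLp f p μ) : MemLp (transfer R B α l f) p μ := by
  have hexpo : MemLp (fun x => expo (-l) x * f x) p μ :=
    hf.of_le ((continuous_expo _).aestronglyMeasurable.mul hf.aestronglyMeasurable)
      (ae_of_all _ fun x => by simp)
  have hsum : MemLp (fun x => ∑ b ∈ B, expo (-l) (tau R b x) * f (tau R b x)) p μ :=
    memLp_finsetSum B fun b hb => h.memLp_comp_tau hb hexpo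
  exact (hsum.const_mul _).const_mul _

lemma sum_integral_norm_sq_transfer (h : IsSelfAffineMeasure R B μ)
    (hT : (matT R B L α)ᴴ * matT R B L α = 1) {f : ℝ → ℂ} (hf : MemLp f 2 μ) :
    ∑ l ∈ L, ∫ x, ‖transfer R B α l f x‖ ^ 2 ∂μ = ∫ x, ‖f x‖ ^ 2 ∂μ := by
  have hsq : ∀ {k : ℝ → ℂ}, MemLp k 2 μ → Integrable (fun x => ‖k x‖ ^ 2) μ := fun hk =>
    (memLp_two_iff_integrable_sq_norm hk.aestronglyMeasurable).1 hk
  rw [← integral_finsetSum _ fun l _ => hsq (h.memLp_transfer α l hf)]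
  simp only [sum_norm_sq_transfer hT]
  rw [integral_const_mul, integral_finsetSum _ fun b hb => hsq (h.memLp_comp_tau hb hf),
    h.integral_eq (hsq hf), smul_eq_mul]

end IsSelfAffineMeasure

lemma expo_neg_mul_transfer (hR : R ≠ 0) (l n : ℤ) (f : ℝ → ℂ) (x : ℝ) :
    expo (-n) x * transfer R B α l f x = conj (α l) * ((B.card : ℂ)⁻¹ *
      ∑ b ∈ B, expo (-(l + R * n : ℤ)) (tau R b x) * f (tau R b x)) := by
  have hexpo : ∀ b : ℤ, expo (-(l + R * n : ℤ)) (tau R b x) =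
      expo (-n) x * expo (-l) (tau R b x) := by
    intro b
    have hR' : (R : ℝ) ≠ 0 := Int.cast_ne_zero.2 hR
    have hdiv : -(R * n : ℝ) / R = (-n : ℤ) := by
      push_cast
      field_simp
    rw [Int.cast_add, neg_add, expo_add_left, Int.cast_mul, expo_tau R b (-(R * n)), hdiv,
      expo_intCast, mul_one, mul_comm, Int.cast_neg]
  simp only [transfer, hexpo, mul_assoc, ← Finset.mul_sum]
  ring

/-! ### Frame coefficients -/

/-- The coefficient `⟨v_w, f⟩` of `f` with respect to the weighted exponential `v_w` of the word
`w`. -/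
def coeff (R : ℤ) (α : ℤ → ℂ) (μ : Measure ℝ) (w : List ℤ) (f : ℝ → ℂ) : ℂ :=
  conj (w.map α).prod * ∫ x, expo (-freq R w) x * f x ∂μ

@[simp] lemma coeff_nil (R : ℤ) (α : ℤ → ℂ) (μ : Measure ℝ) (f : ℝ → ℂ) :
    coeff R α μ [] f = ∫ x, f x ∂μ := by
  simp [coeff, freq]

lemma coeff_singleton_zero (R : ℤ) (hα : α 0 = 1) (μ : Measure ℝ) (f : ℝ → ℂ) :
    coeff R α μ [0] f = coeff R α μ [] f := by
  simp [coeff, freq, hα]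

lemma coeff_const_mul (R : ℤ) (α : ℤ → ℂ) (μ : Measure ℝ) (w : List ℤ) (c : ℂ) (f : ℝ → ℂ) :
    coeff R α μ w (fun x => c * f x) = c * coeff R α μ w f := by
  simp only [coeff, mul_left_comm _ c, integral_const_mul]

namespace IsSelfAffineMeasure

lemma integral_expo_neg_mul_transfer (hR : R ≠ 0) (h : IsSelfAffineMeasure R B μ) (α : ℤ → ℂ)
    (l n : ℤ) {f : ℝ → ℂ} (hf : Integrable f μ) :
    ∫ x, expo (-n) x * transfer R B α l f x ∂μ =
      conj (α l) * ∫ x, expo (-(l + R * n : ℤ)) x * f x ∂μ := by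
  have hint := integrable_expo_mul hf (-(l + R * n : ℤ))
  have hint_tau : ∀ b ∈ B, Integrable
      (fun x => expo (-(l + R * n : ℤ)) (tau R b x) * f (tau R b x)) μ := fun b hb =>
    memLp_one_iff_integrable.1 (h.memLp_comp_tau hb (memLp_one_iff_integrable.2 hint))
  simp only [expo_neg_mul_transfer hR, integral_const_mul, h.integral_eq hint,
    integral_finsetSum B hint_tau, Complex.real_smul, Complex.ofReal_inv, Complex.ofReal_natCast]

lemma coeff_cons (hR : R ≠ 0) (h : IsSelfAffineMeasure R B μ) (α : ℤ → ℂ) (l : ℤ) (w : List ℤ)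
    {f : ℝ → ℂ} (hf : Integrable f μ) :
    coeff R α μ (l :: w) f = coeff R α μ w (transfer R B α l f) := by
  rw [coeff, coeff, h.integral_expo_neg_mul_transfer hR α l (freq R w) hf, List.map_cons,
    List.prod_cons, map_mul, freq]
  ring

lemma coeff_cons_expo (hR : R ≠ 0) (h : IsSelfAffineMeasure R B μ) (α : ℤ → ℂ) (l : ℤ)
    (w : List ℤ) (t : ℝ) :
    coeff R α μ (l :: w) (expo t) =
      conj (α l) * mB B (g R l t) * coeff R α μ w (expo (g R l t)) := by
  have := h.isProbabilityMeasure
  rw [h.coeff_cons hR α l w ((memLp_expo μ t 1).integrable le_rfl), ← coeff_const_mul,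
    funext (transfer_expo R B α l t)]

end IsSelfAffineMeasure

/-! ### Words and Bessel's inequality -/

/-- The empty word. -/
def emptyWord (L : Finset ℤ) : Words L := ⟨[], by simp⟩

/-- Prepend a letter to a word in `Ω(L)`, where the letter `0` in front of the empty word is
dropped. -/
def consWord (p : L × Words L) : Words L :=
  ⟨if (p.1 : ℤ) = 0 ∧ p.2.1 = [] then [] else (p.1 : ℤ) :: p.2.1, by
    obtain ⟨⟨l, hl⟩, ⟨w, hw⟩⟩ := p
    split_ifs with h
    · simp
    · refine ⟨by simpa [hl] using hw.1, ?_⟩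
      cases w with
      | nil => simpa using h
      | cons a w => simpa [List.getLast?_cons_cons] using hw.2⟩

lemma consWord_injective : Function.Injective (consWord : L × Words L → Words L) := by
  rintro ⟨⟨l, hl⟩, ⟨w, hw⟩⟩ ⟨⟨l', hl'⟩, ⟨w', hw'⟩⟩ h
  replace h := congrArg Subtype.val h
  simp only [consWord] at h
  split_ifs at h with h₁ h₂ h₂
  · obtain ⟨rfl, rfl⟩ := h₁
    obtain ⟨rfl, rfl⟩ := h₂
    rfl
  · obtain ⟨rfl, rfl⟩ := List.cons.inj h
    rfl

lemma consWord_surjective (hL0 : 0 ∈ L) :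
    Function.Surjective (consWord : L × Words L → Words L) := by
  rintro ⟨w, hw⟩
  cases w with
  | nil => exact ⟨(⟨0, hL0⟩, emptyWord L), Subtype.ext (by simp [consWord, emptyWord])⟩
  | cons l w =>
    have hlast : ∀ a ∈ w.getLast?, a ≠ 0 := by
      cases w with
      | nil => simp
      | cons a w => simpa [List.getLast?_cons_cons] using hw.2
    have hne : ¬(l = 0 ∧ w = []) := by
      rintro ⟨rfl, rfl⟩
      exact hw.2 0 rfl rfl
    exact ⟨(⟨l, hw.1 l List.mem_cons_self⟩, ⟨w, fun a ha => hw.1 a (.tail l ha), hlast⟩),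
      Subtype.ext (if_neg hne)⟩

/-- The bijection behind all sums over `Ω(L)`: a word splits into its first letter and the rest,
where the empty word counts as the letter `0` followed by the empty word. -/
def wordsEquiv (hL0 : 0 ∈ L) : L × Words L ≃ Words L :=
  Equiv.ofBijective consWord ⟨consWord_injective, consWord_surjective hL0⟩

lemma length_le_of_consWord {p : L × Words L} {n : ℕ} (h : (consWord p).1.length ≤ n + 1) :
    p.2.1.length ≤ n := by
  simp only [consWord] at h
  split_ifs at h with h₀
  · simp [h₀.2]
  · simpa using h

lemma exists_subset_map_wordsEquiv (hL0 : 0 ∈ L) {F : Finset (Words L)} {n : ℕ}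
    (hF : ∀ w ∈ F, w.1.length ≤ n + 1) :
    ∃ G : Finset (Words L), (∀ w ∈ G, w.1.length ≤ n) ∧
      F ⊆ (Finset.univ ×ˢ G).map (wordsEquiv hL0).toEmbedding := by
  classical
  have he : ∀ w, consWord ((wordsEquiv hL0).symm w) = w := (wordsEquiv hL0).apply_symm_apply
  refine ⟨F.image fun w => ((wordsEquiv hL0).symm w).2, ?_, fun w hw => ?_⟩
  · refine Finset.forall_mem_image.2 fun w hw => length_le_of_consWord ?_
    rw [he]
    exact hF w hw
  · refine Finset.mem_map.2 ⟨(wordsEquiv hL0).symm w, Finset.mem_product.2 ⟨Finset.mem_univ _, ?_⟩,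
      he w⟩
    exact Finset.mem_image_of_mem _ hw

/-- The energy `∑_w |⟨v_w, e_t⟩|²` of the frame coefficients of `e_t`, whose value is `1` for all
`t` if the family is a Parseval frame. The sum converges by `summable_norm_coeff_sq`. -/
def energy (R : ℤ) (L : Finset ℤ) (α : ℤ → ℂ) (μ : Measure ℝ) (t : ℝ) : ℝ :=
  ∑' w : Words L, ‖coeff R α μ w.1 (expo t)‖ ^ 2

namespace IsSelfAffineMeasure

lemma coeff_consWord (hR : R ≠ 0) (h : IsSelfAffineMeasure R B μ) (hα : α 0 = 1)
    (p : L × Words L) {f : ℝ → ℂ} (hf : Integrable f μ) :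
    coeff R α μ (consWord p).1 f = coeff R α μ p.2.1 (transfer R B α p.1 f) := by
  rw [← h.coeff_cons hR α p.1 p.2.1 hf]
  simp only [consWord]
  split_ifs with h₀
  · rw [h₀.1, h₀.2, coeff_singleton_zero R hα]
  · rfl

lemma sum_norm_coeff_sq_le (hR : R ≠ 0) (h : IsSelfAffineMeasure R B μ) (hL0 : 0 ∈ L)
    (hα : α 0 = 1) (hT : (matT R B L α)ᴴ * matT R B L α = 1) {f : ℝ → ℂ} (hf : MemLp f 2 μ)
    (F : Finset (Words L)) :
    ∑ w ∈ F, ‖coeff R α μ w.1 f‖ ^ 2 ≤ ∫ x, ‖f x‖ ^ 2 ∂μ := by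
  have := h.isProbabilityMeasure
  obtain ⟨n, hn⟩ : ∃ n, ∀ w ∈ F, w.1.length ≤ n :=
    ⟨F.sup fun w => w.1.length, fun w hw => Finset.le_sup (f := fun w : Words L => w.1.length) hw⟩
  induction n generalizing f F with
  | zero =>
    have hF : F ⊆ {emptyWord L} := fun w hw =>
      Finset.mem_singleton.2 (Subtype.ext (List.length_eq_zero_iff.1 (Nat.le_zero.1 (hn w hw))))
    refine (Finset.sum_le_sum_of_subset_of_nonneg hF fun _ _ _ => sq_nonneg _).trans ?_
    rw [Finset.sum_singleton, emptyWord, coeff_nil]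
    exact norm_integral_sq_le hf
  | succ n ih =>
    obtain ⟨G, hG, hFG⟩ := exists_subset_map_wordsEquiv hL0 hn
    calc ∑ w ∈ F, ‖coeff R α μ w.1 f‖ ^ 2
        ≤ ∑ w ∈ (Finset.univ ×ˢ G).map (wordsEquiv hL0).toEmbedding, ‖coeff R α μ w.1 f‖ ^ 2 :=
          Finset.sum_le_sum_of_subset_of_nonneg hFG fun _ _ _ => sq_nonneg _
      _ = ∑ p ∈ (Finset.univ : Finset L) ×ˢ G, ‖coeff R α μ p.2.1 (transfer R B α p.1 f)‖ ^ 2 := by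
          rw [Finset.sum_map]
          exact Finset.sum_congr rfl fun p _ =>
            congrArg (‖·‖ ^ 2) (h.coeff_consWord hR hα p (hf.integrable one_le_two))
      _ = ∑ l : L, ∑ w ∈ G, ‖coeff R α μ w.1 (transfer R B α l f)‖ ^ 2 :=
          Finset.sum_product _ _ _
      _ ≤ ∑ l : L, ∫ x, ‖transfer R B α l f x‖ ^ 2 ∂μ :=
          Finset.sum_le_sum fun l _ => ih (h.memLp_transfer α l hf) G hG
      _ = ∫ x, ‖f x‖ ^ 2 ∂μ := by
          rw [Finset.sum_coe_sort L fun l => ∫ x, ‖transfer R B α l f x‖ ^ 2 ∂μ]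
          exact h.sum_integral_norm_sq_transfer hT hf

lemma summable_norm_coeff_sq (hR : R ≠ 0) (h : IsSelfAffineMeasure R B μ) (hL0 : 0 ∈ L)
    (hα : α 0 = 1) (hT : (matT R B L α)ᴴ * matT R B L α = 1) {f : ℝ → ℂ} (hf : MemLp f 2 μ) :
    Summable fun w : Words L => ‖coeff R α μ w.1 f‖ ^ 2 :=
  summable_of_sum_le (fun _ => sq_nonneg _) (h.sum_norm_coeff_sq_le hR hL0 hα hT hf)

lemma energy_le_one (hR : R ≠ 0) (h : IsSelfAffineMeasure R B μ) (hL0 : 0 ∈ L) (hα : α 0 = 1)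
    (hT : (matT R B L α)ᴴ * matT R B L α = 1) (t : ℝ) : energy R L α μ t ≤ 1 := by
  have := h.isProbabilityMeasure
  have hf := memLp_expo μ t 2
  refine (h.summable_norm_coeff_sq hR hL0 hα hT hf).tsum_le_of_sum_le fun F => ?_
  simpa using h.sum_norm_coeff_sq_le hR hL0 hα hT hf F

lemma energy_zero (hR : R ≠ 0) (h : IsSelfAffineMeasure R B μ) (hL0 : 0 ∈ L) (hα : α 0 = 1)
    (hT : (matT R B L α)ᴴ * matT R B L α = 1) : energy R L α μ 0 = 1 := by
  have := h.isProbabilityMeasure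
  refine le_antisymm (h.energy_le_one hR hL0 hα hT 0) ?_
  have hempty := (h.summable_norm_coeff_sq hR hL0 hα hT (memLp_expo μ 0 2)).le_tsum
    (emptyWord L) fun _ _ => sq_nonneg _
  simpa [emptyWord, energy] using hempty

lemma sum_transitionProb_mul_energy (hR : R ≠ 0) (h : IsSelfAffineMeasure R B μ) (hL0 : 0 ∈ L)
    (hα : α 0 = 1) (hT : (matT R B L α)ᴴ * matT R B L α = 1) (t : ℝ) :
    ∑ l ∈ L, transitionProb R B α l t * energy R L α μ (g R l t) = energy R L α μ t := by
  have := h.isProbabilityMeasure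
  have hint := (memLp_expo μ t 1).integrable le_rfl
  have hterm : ∀ p : L × Words L, ‖coeff R α μ (wordsEquiv hL0 p).1 (expo t)‖ ^ 2 =
      transitionProb R B α p.1 t * ‖coeff R α μ p.2.1 (expo (g R p.1 t))‖ ^ 2 := by
    intro p
    change ‖coeff R α μ (consWord p).1 (expo t)‖ ^ 2 = _
    rw [h.coeff_consWord hR hα p hint, ← h.coeff_cons hR α _ _ hint, h.coeff_cons_expo hR]
    simp only [norm_mul, RCLike.norm_conj, mul_pow, transitionProb]
  have hsum : Summable fun p : L × Words L =>
      transitionProb R B α p.1 t * ‖coeff R α μ p.2.1 (expo (g R p.1 t))‖ ^ 2 :=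
    ((wordsEquiv hL0).summable_iff.2
      (h.summable_norm_coeff_sq hR hL0 hα hT (memLp_expo μ t 2))).congr hterm
  calc ∑ l ∈ L, transitionProb R B α l t * energy R L α μ (g R l t)
      = ∑ l : L, ∑' w : Words L,
          transitionProb R B α l t * ‖coeff R α μ w.1 (expo (g R l t))‖ ^ 2 := by
        simp only [← Finset.sum_coe_sort L, tsum_mul_left, energy]
    _ = ∑' p : L × Words L,
          transitionProb R B α p.1 t * ‖coeff R α μ p.2.1 (expo (g R p.1 t))‖ ^ 2 := by
        rw [hsum.tsum_prod, tsum_fintype]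
    _ = energy R L α μ t := by
        rw [energy, ← (wordsEquiv hL0).tsum_eq, tsum_congr hterm]

end IsSelfAffineMeasure

/-! ### Harmonic functions and minimal invariant sets -/

lemma exists_isFiniteMinimalInvariant {Z : Set ℝ} (hfin : Z.Finite) (hne : Z.Nonempty)
    (hZ : IsInvariant R B L α Z) : ∃ M ⊆ Z, IsFiniteMinimalInvariant R B L α M := by
  have hsub : {S : Set ℝ | S ⊆ Z ∧ S.Nonempty ∧ IsInvariant R B L α S}.Finite :=
    hfin.finite_subsets.subset fun S hS => hS.1
  obtain ⟨M, hMZ, hM⟩ := hsub.exists_le_minimal (a := Z) ⟨subset_rfl, hne, hZ⟩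
  exact ⟨M, hMZ, hfin.subset hMZ, hM.prop.2, fun S hS hSM =>
    hM.le_of_le ⟨hSM.trans hMZ, hS⟩ hSM⟩

lemma exists_mapsTo_g_Icc (hR : 2 ≤ |R|) (L : Finset ℤ) :
    ∃ K > 0, ∀ l ∈ L, Set.MapsTo (g R l) (Set.Icc (-K) K) (Set.Icc (-K) K) := by
  have hR2 : (2 : ℝ) ≤ |(R : ℝ)| := by exact_mod_cast hR
  set C := ∑ l ∈ L, |(l : ℝ)|
  have hC : 0 ≤ C := by positivity
  refine ⟨C + 1, by positivity, fun l hl t ht => abs_le.1 ?_⟩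
  have hlC : |(l : ℝ)| ≤ C :=
    Finset.single_le_sum (f := fun l : ℤ => |(l : ℝ)|) (fun _ _ => abs_nonneg _) hl
  have htC : |t| ≤ C + 1 := abs_le.2 ht
  rw [g, abs_div, div_le_iff₀ (by linarith)]
  nlinarith [abs_sub t (l : ℝ)]

lemma isInvariant_setOf_eq_min (hB : B.Nonempty) (hT : (matT R B L α)ᴴ * matT R B L α = 1)
    {S : Set ℝ} (hS : ∀ l ∈ L, Set.MapsTo (g R l) S S) {h : ℝ → ℝ} {m : ℝ}
    (hm : ∀ t ∈ S, m ≤ h t)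
    (hfix : ∀ t, ∑ l ∈ L, transitionProb R B α l t * h (g R l t) = h t) :
    IsInvariant R B L α {t ∈ S | h t = m} := by
  rintro t ⟨htS, rfl⟩ l hl hne
  refine ⟨hS l hl htS, ?_⟩
  have hsum : ∑ l ∈ L, transitionProb R B α l t * (h (g R l t) - h t) = 0 := by
    simp only [mul_sub, Finset.sum_sub_distrib, ← Finset.sum_mul]
    rw [hfix, sum_transitionProb hB hT, one_mul, sub_self]
  have hnonneg : ∀ l ∈ L, 0 ≤ transitionProb R B α l t * (h (g R l t) - h t) := fun l hl =>
    mul_nonneg (transitionProb_nonneg ..) (sub_nonneg.2 (hm _ (hS l hl htS)))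
  have hzero := (Finset.sum_eq_zero_iff_of_nonneg hnonneg).1 hsum l hl
  exact sub_eq_zero.1 ((mul_eq_zero.1 hzero).resolve_left (mt transitionProb_eq_zero_iff.1 hne))

/-- The points of an interval where `h` is minimal form an invariant set; if it were finite, it
would contain `0` and `h` would be constant on the interval. So it is infinite, and it
accumulates. -/
lemma eq_one_of_analytic (hR : 2 ≤ |R|) (hB : B.Nonempty)
    (hT : (matT R B L α)ᴴ * matT R B L α = 1)
    (hmin : ∀ M : Set ℝ, IsFiniteMinimalInvariant R B L α M → M = {0})
    {h : ℝ → ℝ} (han : AnalyticOnNhd ℝ h Set.univ) (hle : ∀ t, h t ≤ 1) (h0 : h 0 = 1)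
    (hfix : ∀ t, ∑ l ∈ L, transitionProb R B α l t * h (g R l t) = h t) :
    h = fun _ => 1 := by
  obtain ⟨K, hK, hg⟩ := exists_mapsTo_g_Icc hR L
  obtain ⟨t₀, ht₀, hm⟩ := isCompact_Icc.exists_isMinOn
    (Set.nonempty_Icc.2 (neg_lt_self hK).le) (han.continuousOn.mono (Set.subset_univ _))
  have hinv := isInvariant_setOf_eq_min hB hT hg (fun t ht => hm ht) hfix
  have hinf : {t ∈ Set.Icc (-K) K | h t = h t₀}.Infinite := by
    intro hfin
    obtain ⟨M, hM, hMmin⟩ := exists_isFiniteMinimalInvariant hfin ⟨t₀, ht₀, rfl⟩ hinv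
    have h0t₀ : h 0 = h t₀ := (hM (hmin M hMmin ▸ rfl)).2
    refine Set.Icc_infinite (neg_lt_self hK) (hfin.subset fun t ht => ⟨ht, ?_⟩)
    exact le_antisymm ((hle t).trans_eq (h0.symm.trans h0t₀)) (hm ht)
  obtain ⟨z, -, hz⟩ := hinf.exists_accPt_of_subset_isCompact isCompact_Icc fun t ht => ht.1
  have hconst : h = fun _ => h t₀ := han.eq_of_frequently_eq analyticOnNhd_const
    ((accPt_iff_frequently_nhdsNE.1 hz).mono fun t ht => ht.2)
  rw [hconst, ← h0, congrFun hconst 0]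

lemma isHarmonic_one (hB : B.Nonempty) (hT : (matT R B L α)ᴴ * matT R B L α = 1) :
    IsHarmonic R B L α fun _ => 1 where
  entire := differentiable_const _
  real_on_reals _ := Complex.one_im
  bounds _ := by simp
  at_zero := rfl
  fixed t := by
    have h := sum_transitionProb hB hT t
    simp only [mul_one]
    exact_mod_cast h

lemma IsHarmonic.eq_one (hR : 2 ≤ |R|) (hB : B.Nonempty)
    (hT : (matT R B L α)ᴴ * matT R B L α = 1)
    (hmin : ∀ M : Set ℝ, IsFiniteMinimalInvariant R B L α M → M = {0}) {h : ℂ → ℂ}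
    (hh : IsHarmonic R B L α h) : h = fun _ => 1 := by
  have han : AnalyticOnNhd ℂ h Set.univ := fun z _ => hh.entire.analyticAt z
  have han_re : AnalyticOnNhd ℝ (fun t : ℝ => (h t).re) Set.univ := fun t _ =>
    (Complex.reCLM.analyticAt _).comp
      ((han t trivial).restrictScalars.comp (Complex.ofRealCLM.analyticAt t))
  have hfix : ∀ t : ℝ, ∑ l ∈ L, transitionProb R B α l t * (h (g R l t)).re = (h t).re := by
    intro t
    have hre := congrArg Complex.re (hh.fixed t)
    rwa [Complex.re_sum, Finset.sum_congr rfl fun l _ => Complex.re_ofReal_mul ..] at hre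
  have hreal := congrFun <| eq_one_of_analytic hR hB hT hmin han_re (fun t => (hh.bounds t).2)
    (by simp [hh.at_zero]) hfix
  have hone : ∀ t : ℝ, h t = 1 := fun t => Complex.ext (hreal t) (hh.real_on_reals t)
  have hofReal : Filter.Tendsto Complex.ofReal (nhdsWithin 0 {0}ᶜ) (nhdsWithin 0 {0}ᶜ) :=
    Complex.continuous_ofReal.continuousWithinAt.tendsto_nhdsWithin fun t ht => by simpa using ht
  exact han.eq_of_frequently_eq analyticOnNhd_const
    (hofReal.frequently (Filter.Eventually.of_forall hone).frequently)

/-! ### Totality of the exponentials -/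

section FourierUniqueness

variable {E : Type*} [NormedAddCommGroup E] [InnerProductSpace ℝ E] [MeasurableSpace E]
  {ν : Measure E}

lemma charFun_withDensity_ofReal {f : E → ℝ} (hf : AEMeasurable f ν) (t : E) :
    charFun (ν.withDensity fun x => ENNReal.ofReal (f x)) t =
      ∫ x, Complex.exp (inner ℝ x t * Complex.I) * (max (f x) 0 : ℝ) ∂ν := by
  rw [charFun_apply, integral_withDensity_eq_integral_toReal_smul₀ hf.ennreal_ofReal (by simp)]
  simp only [ENNReal.toReal_ofReal', Complex.real_smul, mul_comm]

variable [BorelSpace E] [SecondCountableTopology E]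

lemma integrable_exp_inner_mul {f : E → ℂ} (hf : Integrable f ν) (t : E) :
    Integrable (fun x => Complex.exp (inner ℝ x t * Complex.I) * f x) ν :=
  hf.bdd_mul (c := 1) (by fun_prop)
    (ae_of_all _ fun x => (Complex.norm_exp_ofReal_mul_I _).le)

variable [CompleteSpace E]

lemma ae_eq_zero_of_integral_exp_inner_mul_ofReal {f : E → ℝ} (hf : Integrable f ν)
    (h : ∀ t, ∫ x, Complex.exp (inner ℝ x t * Complex.I) * f x ∂ν = 0) : f =ᵐ[ν] 0 := by
  have := isFiniteMeasure_withDensity_ofReal hf.2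
  have := isFiniteMeasure_withDensity_ofReal hf.neg.2
  have hint : ∀ {k : E → ℝ}, Integrable k ν → ∀ t, Integrable
      (fun x => Complex.exp (inner ℝ x t * Complex.I) * (max (k x) 0 : ℝ)) ν :=
    fun hk t => integrable_exp_inner_mul (hk.pos_part.ofReal (𝕜 := ℂ)) t
  have heq : (ν.withDensity fun x => ENNReal.ofReal (f x)) =
      ν.withDensity fun x => ENNReal.ofReal ((-f) x) := by
    refine Measure.ext_of_charFun (funext fun t => ?_)
    rw [charFun_withDensity_ofReal hf.aemeasurable, charFun_withDensity_ofReal hf.neg.aemeasurable,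
      ← sub_eq_zero, ← integral_sub (hint hf t) (hint hf.neg t), ← h t]
    simp only [← mul_sub, ← Complex.ofReal_sub, Pi.neg_apply, max_zero_sub_max_neg_zero_eq_self]
  have hae := (withDensity_eq_iff hf.aemeasurable.ennreal_ofReal
    hf.neg.aemeasurable.ennreal_ofReal hf.lintegral_lt_top.ne).1 heq
  filter_upwards [hae] with x hx
  have hmax := congrArg ENNReal.toReal hx
  rw [ENNReal.toReal_ofReal', ENNReal.toReal_ofReal'] at hmax
  exact (max_zero_sub_max_neg_zero_eq_self (f x)).symm.trans (sub_eq_zero.2 hmax)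

lemma ae_re_eq_zero_of_integral_exp_inner_mul {f : E → ℂ} (hf : Integrable f ν)
    (h : ∀ t, ∫ x, Complex.exp (inner ℝ x t * Complex.I) * f x ∂ν = 0) :
    (fun x => (f x).re) =ᵐ[ν] 0 := by
  refine ae_eq_zero_of_integral_exp_inner_mul_ofReal hf.re fun t => ?_
  have hfc : Integrable (fun x => conj (f x)) ν :=
    Complex.conjCLE.toContinuousLinearMap.integrable_comp hf
  have hconj : ∫ x, Complex.exp (inner ℝ x t * Complex.I) * conj (f x) ∂ν = 0 := by
    rw [← map_zero conj, ← h (-t), ← integral_conj]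
    simp [← Complex.exp_conj]
  have hre : ∀ x, Complex.exp (inner ℝ x t * Complex.I) * ((f x).re : ℂ) =
      (Complex.exp (inner ℝ x t * Complex.I) * f x +
        Complex.exp (inner ℝ x t * Complex.I) * conj (f x)) / 2 := fun x => by
    rw [Complex.re_eq_add_conj]
    ring
  refine (integral_congr_ae (ae_of_all _ hre)).trans ?_
  rw [integral_div, integral_add (integrable_exp_inner_mul hf t) (integrable_exp_inner_mul hfc t),
    h, hconj, add_zero, zero_div]

lemma ae_eq_zero_of_integral_exp_inner_mul {f : E → ℂ} (hf : Integrable f ν)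
    (h : ∀ t, ∫ x, Complex.exp (inner ℝ x t * Complex.I) * f x ∂ν = 0) : f =ᵐ[ν] 0 := by
  have hI : ∀ t, ∫ x, Complex.exp (inner ℝ x t * Complex.I) * (-Complex.I * f x) ∂ν = 0 :=
    fun t => by simp only [mul_left_comm _ (-Complex.I), integral_const_mul, h, mul_zero]
  filter_upwards [ae_re_eq_zero_of_integral_exp_inner_mul hf h,
    ae_re_eq_zero_of_integral_exp_inner_mul (hf.const_mul (-Complex.I)) hI] with x hre him
  exact Complex.ext hre (by simpa using him)

end FourierUniqueness

lemma dense_span_range_expL2 (μ : Measure ℝ) [IsFiniteMeasure μ] :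
    Dense (Submodule.span ℂ (Set.range (expL2 μ)) : Set (Lp ℂ 2 μ)) := by
  rw [Submodule.dense_iff_topologicalClosure_eq_top, Submodule.topologicalClosure_eq_top_iff,
    Submodule.eq_bot_iff]
  intro f hf
  have hortho : ∀ t, ∫ x, expo t x * f x ∂μ = 0 := fun t => by
    rw [← neg_neg t, ← inner_expL2]
    exact Submodule.inner_right_of_mem_orthogonal
      (Submodule.subset_span (Set.mem_range_self (-t))) hf
  refine (Lp.eq_zero_iff_ae_eq_zero).2 (ae_eq_zero_of_integral_exp_inner_mul
    ((Lp.memLp f).integrable one_le_two) fun t => ?_)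
  rw [← hortho (t / (2 * Real.pi))]
  refine integral_congr_ae (ae_of_all _ fun x => congrArg (· * f x) ?_)
  have hpi : (Real.pi : ℂ) ≠ 0 := Complex.ofReal_ne_zero.2 Real.pi_ne_zero
  rw [expo_eq_exp, RCLike.inner_apply, conj_trivial]
  push_cast
  field_simp

/-! ### Analyticity of `t ↦ e_t` -/

/-- The bounded function `x ↦ 2πi x` cut off outside `[-K, K]`. -/
def cutoffExponent {K : ℝ} (hK : -K ≤ K) : BoundedContinuousFunction ℝ ℂ :=
  (BoundedContinuousFunction.mkOfCompact (ContinuousMap.mk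
    (fun x : Set.Icc (-K) K => 2 * Real.pi * Complex.I * (x : ℝ)) (by fun_prop))).compContinuous
    (ContinuousMap.mk (Set.projIcc (-K) K hK) continuous_projIcc)

lemma cutoffExponent_apply {K : ℝ} (hK : -K ≤ K) {x : ℝ} (hx : |x| ≤ K) :
    cutoffExponent hK x = 2 * Real.pi * Complex.I * x := by
  change 2 * Real.pi * Complex.I * ((Set.projIcc (-K) K hK x : ℝ) : ℂ) = _
  rw [Set.projIcc_of_mem hK (abs_le.1 hx)]

lemma exp_boundedContinuousFunction_apply {X : Type*} [TopologicalSpace X]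
    (f : BoundedContinuousFunction X ℂ) (x : X) :
    NormedSpace.exp f x = Complex.exp (f x) := by
  let ev : BoundedContinuousFunction X ℂ →+* ℂ :=
    { toFun := fun f => f x
      map_one' := rfl
      map_mul' := fun _ _ => rfl
      map_zero' := rfl
      map_add' := fun _ _ => rfl }
  have hev : Continuous ev := (BoundedContinuousFunction.evalCLM ℂ x).continuous
  rw [Complex.exp_eq_exp_ℂ]
  exact NormedSpace.map_exp ev hev f

/-- On the support of `μ`, `e_t` is the exponential of `t` times a fixed element of the Banach
algebra of bounded continuous functions. -/
lemma contDiff_expL2 [IsFiniteMeasure μ] {K : ℝ} (hK : 0 ≤ K) (hμ : ∀ᵐ x ∂μ, |x| ≤ K) :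
    ContDiff ℝ ω (expL2 μ) := by
  let φ := cutoffExponent (neg_le_self hK)
  have heq : expL2 μ =
      fun t : ℝ => BoundedContinuousFunction.toLp 2 μ ℝ (NormedSpace.exp (t • φ)) := by
    refine funext fun t => Lp.ext ?_
    filter_upwards [coeFn_expL2 μ t, BoundedContinuousFunction.coeFn_toLp (p := 2) (𝕜 := ℝ) μ
      (NormedSpace.exp (t • φ)), hμ] with x hexpL2 htoLp hx
    rw [hexpL2, htoLp, exp_boundedContinuousFunction_apply, expo_eq_exp,
      BoundedContinuousFunction.smul_apply, Complex.real_smul, cutoffExponent_apply _ hx]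
    ring_nf
  have hexp : ContDiff ℝ ω (NormedSpace.exp : BoundedContinuousFunction ℝ ℂ → _) :=
    contDiff_omega_iff_analyticOnNhd.2 fun x _ => NormedSpace.exp_analytic x
  rw [heq]
  exact (BoundedContinuousFunction.toLp 2 μ ℝ : _ →L[ℝ] Lp ℂ 2 μ).contDiff.comp
    (hexp.comp (contDiff_id.smul contDiff_const))

/-! ### The family of weighted exponentials -/

lemma inner_weightedExp (w : Words L) (f : Lp ℂ 2 (selfAffineMeasure R B)) :
    inner ℂ (weightedExp R B L α w) f = coeff R α (selfAffineMeasure R B) w.1 f := by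
  rw [weightedExp, inner_smul_left, inner_expL2, coeff]

lemma inner_weightedExp_expL2 (w : Words L) (t : ℝ) :
    inner ℂ (weightedExp R B L α w) (expL2 (selfAffineMeasure R B) t) =
      coeff R α (selfAffineMeasure R B) w.1 (expo t) := by
  rw [inner_weightedExp, coeff, coeff]
  congr 1
  refine integral_congr_ae ?_
  filter_upwards [coeFn_expL2 (selfAffineMeasure R B) t] with x hx
  rw [hx]

lemma isBessel_weightedExp (hR : 2 ≤ |R|) (hB : B.Nonempty) (hL0 : 0 ∈ L) (hα : α 0 = 1)
    (hT : (matT R B L α)ᴴ * matT R B L α = 1) : IsBessel (weightedExp R B L α) := by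
  intro f F
  have hR0 : R ≠ 0 := abs_pos.1 (two_pos.trans_le hR)
  simp only [inner_weightedExp, norm_sq_Lp_two]
  exact (isSelfAffineMeasure_selfAffineMeasure hR hB).sum_norm_coeff_sq_le hR0 hL0 hα hT
    (Lp.memLp f) F

lemma analyticOnNhd_energy (hR : 2 ≤ |R|) (hB : B.Nonempty) (hL0 : 0 ∈ L) (hα : α 0 = 1)
    (hT : (matT R B L α)ᴴ * matT R B L α = 1) :
    AnalyticOnNhd ℝ (energy R L α (selfAffineMeasure R B)) Set.univ := by
  have hbessel := isBessel_weightedExp hR hB hL0 hα hT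
  have hexpL2 : ContDiff ℝ ω (expL2 (selfAffineMeasure R B)) := contDiff_expL2 (by positivity)
    ((isSelfAffineMeasure_selfAffineMeasure hR hB).ae_abs_le hR)
  have henergy : energy R L α (selfAffineMeasure R B) =
      fun t => ‖hbessel.analysisOp (expL2 (selfAffineMeasure R B) t)‖ ^ 2 := funext fun t => by
    simp only [← (hbessel.hasSum_norm_inner_sq _).tsum_eq, inner_weightedExp_expL2, energy]
  rw [← contDiff_omega_iff_analyticOnNhd, henergy]
  exact ((hbessel.analysisOp.restrictScalars ℝ).contDiff.comp hexpL2).norm_sq ℂ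

theorem isParsevalFrame_weightedExp (hR : 2 ≤ |R|) (hB : B.Nonempty) (hL0 : 0 ∈ L)
    (hα : α 0 = 1) (hT : (matT R B L α)ᴴ * matT R B L α = 1)
    (hmin : ∀ M : Set ℝ, IsFiniteMinimalInvariant R B L α M → M = {0}) :
    IsParsevalFrame (weightedExp R B L α) := by
  have hR0 : R ≠ 0 := abs_pos.1 (two_pos.trans_le hR)
  have hμ := isSelfAffineMeasure_selfAffineMeasure hR hB
  have := hμ.isProbabilityMeasure
  have henergy : energy R L α (selfAffineMeasure R B) = fun _ => 1 :=
    eq_one_of_analytic hR hB hT hmin (analyticOnNhd_energy hR hB hL0 hα hT)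
      (hμ.energy_le_one hR0 hL0 hα hT) (hμ.energy_zero hR0 hL0 hα hT)
      (hμ.sum_transitionProb_mul_energy hR0 hL0 hα hT)
  refine (isBessel_weightedExp hR hB hL0 hα hT).isParsevalFrame (dense_span_range_expL2 _) ?_
  rintro _ ⟨t, rfl⟩
  rw [norm_expL2, one_pow, ← congrFun henergy t]
  simp only [inner_weightedExp_expL2, energy]

/-! ### Nontrivial finite invariant sets -/

lemma g_zero_left (R : ℤ) (t : ℝ) : g R 0 t = t / R := by simp [g]

lemma isInvariant_singleton_zero (hB : B.Nonempty) (hL0 : 0 ∈ L) (hα : α 0 = 1)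
    (hT : (matT R B L α)ᴴ * matT R B L α = 1) : IsInvariant R B L α {0} := by
  rintro _ rfl l hl hne
  have hprob : transitionProb R B α 0 0 = 1 := by
    simp [transitionProb, g_zero_left, hα, mB_zero hB]
  obtain rfl | hl0 := eq_or_ne l 0
  · simp [g_zero_left]
  have hsum := sum_transitionProb hB hT 0
  rw [← Finset.add_sum_erase _ _ hL0, hprob, add_eq_left] at hsum
  have hzero := (Finset.sum_eq_zero_iff_of_nonneg fun _ _ => transitionProb_nonneg ..).1 hsum l
    (Finset.mem_erase.2 ⟨hl0, hl⟩)
  exact absurd (transitionProb_eq_zero_iff.1 hzero) hne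

lemma IsFiniteMinimalInvariant.zero_notMem (hB : B.Nonempty) (hL0 : 0 ∈ L) (hα : α 0 = 1)
    (hT : (matT R B L α)ᴴ * matT R B L α = 1) {M : Set ℝ}
    (hM : IsFiniteMinimalInvariant R B L α M) (hM0 : M ≠ {0}) : (0 : ℝ) ∉ M := fun h0 =>
  hM0 (hM.2.eq_of_subset
    ⟨Set.singleton_nonempty 0, isInvariant_singleton_zero hB hL0 hα hT⟩
    (Set.singleton_subset_iff.2 h0)).symm

lemma injective_div_pow {r c : ℝ} (hr : 1 < |r|) (hc : c ≠ 0) :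
    Function.Injective fun n : ℕ => c / r ^ n := by
  intro m n hmn
  have habs : |r| ^ m = |r| ^ n := by
    rw [← abs_pow, ← abs_pow, inv_injective (mul_left_cancel₀ hc hmn)]
  exact pow_right_injective₀ (zero_lt_one.trans hr) hr.ne' habs

/-- Otherwise the orbit `c / Rⁿ` of `c` under `g_0` would stay in the finite set `M`. -/
lemma IsSelfAffineMeasure.integral_expo_eq_zero (hR : 2 ≤ |R|) (h : IsSelfAffineMeasure R B μ)
    (hL0 : 0 ∈ L) (hα : α 0 = 1) {M : Set ℝ} (hfin : M.Finite) (hM : IsInvariant R B L α M)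
    {c : ℝ} (hc : c ∈ M) (hc0 : c ≠ 0) : ∫ x, expo c x ∂μ = 0 := by
  by_contra hne
  have horbit : ∀ n : ℕ, c / (R : ℝ) ^ n ∈ M ∧ ∫ x, expo (c / (R : ℝ) ^ n) x ∂μ ≠ 0 := by
    intro n
    induction n with
    | zero => simpa using ⟨hc, hne⟩
    | succ n ih =>
      rw [pow_succ, ← div_div]
      have hstep := ih.2
      rw [h.integral_expo] at hstep
      refine ⟨?_, right_ne_zero_of_mul hstep⟩
      have hmem := hM _ ih.1 0 hL0
      rw [g_zero_left, hα, one_mul] at hmem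
      exact hmem (left_ne_zero_of_mul hstep)
  have hR1 : (1 : ℝ) < |(R : ℝ)| := by exact_mod_cast one_lt_two.trans_le hR
  exact Set.infinite_of_injective_forall_mem (injective_div_pow hR1 hc0)
    (fun n => (horbit n).1) hfin

lemma IsSelfAffineMeasure.coeff_expo_eq_zero (hR : 2 ≤ |R|) (h : IsSelfAffineMeasure R B μ)
    (hL0 : 0 ∈ L) (hα : α 0 = 1) {M : Set ℝ} (hfin : M.Finite) (hM : IsInvariant R B L α M)
    (h0 : (0 : ℝ) ∉ M) {w : List ℤ} (hw : ∀ l ∈ w, l ∈ L) {c : ℝ} (hc : c ∈ M) :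
    coeff R α μ w (expo c) = 0 := by
  induction w generalizing c with
  | nil =>
    rw [coeff_nil]
    exact h.integral_expo_eq_zero hR hL0 hα hfin hM hc (ne_of_mem_of_not_mem hc h0)
  | cons l w ih =>
    rw [h.coeff_cons_expo (abs_pos.1 (two_pos.trans_le hR))]
    by_cases hvanish : α l * mB B (g R l c) = 0
    · rcases mul_eq_zero.1 hvanish with hzero | hzero <;> simp [hzero]
    · rw [ih (fun k hk => hw k (List.mem_cons_of_mem _ hk))
        (hM c hc l (hw l List.mem_cons_self) hvanish), mul_zero]

theorem inner_weightedExp_expL2_eq_zero (hR : 2 ≤ |R|) (hB : B.Nonempty) (hL0 : 0 ∈ L)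
    (hα : α 0 = 1) (hT : (matT R B L α)ᴴ * matT R B L α = 1) {M : Set ℝ}
    (hM : IsFiniteMinimalInvariant R B L α M) (hM0 : M ≠ {0}) {c : ℝ} (hc : c ∈ M)
    (w : Words L) :
    inner ℂ (weightedExp R B L α w) (expL2 (selfAffineMeasure R B) c) = 0 := by
  rw [inner_weightedExp_expL2]
  exact (isSelfAffineMeasure_selfAffineMeasure hR hB).coeff_expo_eq_zero hR hL0 hα hM.1
    hM.2.prop.2 (hM.zero_notMem hB hL0 hα hT hM0) w.2.1 hc

end WeightedFourier

end

open WeightedFourier in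
theorem theorem4p3_general (R : ℤ) (hR : 2 ≤ |R|) (B : Finset ℤ) (hB : B.Nonempty)
    (L : Finset ℤ) (hL0 : 0 ∈ L) (α : ℤ → ℂ) (hα : α 0 = 1)
    (hT : (matT R B L α)ᴴ * matT R B L α = 1) :
    ((∀ M : Set ℝ, IsFiniteMinimalInvariant R B L α M → M = {0}) →
      OnlyConstantHarmonic R B L α ∧ IsParsevalFrame (weightedExp R B L α)) ∧
    (∀ M : Set ℝ, IsFiniteMinimalInvariant R B L α M → M ≠ {0} →
      (∀ c ∈ M, ∀ w : Words L,
        inner ℂ (weightedExp R B L α w) (expL2 (selfAffineMeasure R B) c) = 0) ∧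
      (Submodule.span ℂ (Set.range (weightedExp R B L α))).topologicalClosure ≠ ⊤) := by
  have := (isSelfAffineMeasure_selfAffineMeasure hR hB).isProbabilityMeasure
  refine ⟨fun hmin => ⟨fun h => ⟨fun hh => hh.eq_one hR hB hT hmin, ?_⟩,
    isParsevalFrame_weightedExp hR hB hL0 hα hT hmin⟩, fun M hM hM0 => ?_⟩
  · rintro rfl
    exact isHarmonic_one hB hT
  · have horth : ∀ c ∈ M, ∀ w, _ := fun c hc =>
      inner_weightedExp_expL2_eq_zero hR hB hL0 hα hT hM hM0 hc
    obtain ⟨c, hc⟩ := hM.2.prop.1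
    have hne : expL2 (selfAffineMeasure R B) c ≠ 0 := norm_ne_zero_iff.1 (by simp [norm_expL2])
    exact ⟨horth, topologicalClosure_span_ne_top hne (horth c hc)⟩

theorem theorem4p3 (R : ℤ) (hR : 2 ≤ |R|) (B : Finset ℤ) (hB0 : 0 ∈ B)
    (hno : WeightedFourier.NoOverlap R B)
    (L : Finset ℤ) (hL0 : 0 ∈ L) (α : ℤ → ℂ)
    (hi : α 0 = 1)
    (hii : (WeightedFourier.matT R B L α)ᴴ * WeightedFourier.matT R B L α = 1) :
    ((∀ M : Set ℝ, WeightedFourier.IsFiniteMinimalInvariant R B L α M → M = {0}) →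
      WeightedFourier.OnlyConstantHarmonic R B L α ∧
      WeightedFourier.IsParsevalFrame (WeightedFourier.weightedExp R B L α)) ∧
    (∀ M : Set ℝ, WeightedFourier.IsFiniteMinimalInvariant R B L α M → M ≠ {0} →
      (∀ c ∈ M, ∀ w : WeightedFourier.Words L,
        inner ℂ (WeightedFourier.weightedExp R B L α w)
          (WeightedFourier.expL2 (WeightedFourier.selfAffineMeasure R B) c) = 0) ∧
      (Submodule.span ℂ (Set.range (WeightedFourier.weightedExp R B L α))).topologicalClosure
        ≠ ⊤) :=
  theorem4p3_general R hR B ⟨0, hB0⟩ L hL0 α hi hii
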